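/- Poisson group testing. There are $n$ subjects. The number $D$ of defectives has the right-truncated Poisson distribution $P(D=d)=c(n)\frac{\lambda(n)^d}{d!}e^{-\lambda(n)}$ for $0\le d\le n$, where $c(n)=e^{\lambda(n)}\big/\sum_{k=0}^{n}\frac{\lambda(n)^k}{k!}$ and $\lambda(n)\ge 0$; given $D=d$, the set of defectives $\mathcal D$ is uniform among the $d$-element subsets of the subjects. Independently of $\mathcal D$, a test matrix $C\in\{0,1\}^{m\times n}$ has i.i.d. Bernoulli$(p)$ entries. The vector of test results $y\in\{0,1\}^m$ is the Boolean OR of the columns of $C$ indexed by $\mathcal D$. A maximum likelihood (ML) decoder returns a set $\hat{\mathcal D}$ that maximizes $P(y\mid C,\mathcal D')$ over all sets of subjects $\mathcal D'$. Let $\mathcal E=\{\hat{\mathcal D}\ne\mathcal D\}$, and let $\mathcal E'$ be the event that there is a set of subjects $\mathcal D'\neq\mathcal D$ with $P(y\mid C,\mathcal D')\ge P(y\mid C,\mathcal D)$. Theorem. Suppose that $\lambda(n)=o(n)$ and that $\lim_{n\to\infty}\lambda(n)$ exists with $0<\lim_{n\to\infty}\lambda(n)<\infty$. Let $K>1$ be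 a fixed integer, and let $\beta(n)=\log^{(K)}n=\log\log\cdots\log n$ be the $K$-fold iterated natural logarithm (defined for $n$ large). Let $\gamma>0$ and $\tau>0$ be fixed scalars, let $p=\lceil\beta(n)\lambda(n)\rceil^{-(1+\gamma)}$, and let $m=m(n)$ be integers with $$m(n)\ \ge\ 2\,(\beta(n)\lambda(n))^{1+\gamma}\left(\log n+\tau\,\beta(n)^2\log^2(\beta(n)\lambda(n))\right)$$ for all large $n$; for example, the right-hand side rounded up. Then $\lim_{n\to\infty}P(\mathcal E')=0$, and $\lim_{n\to\infty}P(\mathcal E)=0$ for every choice of ML decoders, however they break ties. -/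

import Mathlib

open Filter Topology Asymptotics

namespace PoissonPGT

/-- The normalization coefficient `c(n) = e^r / ∑_{k ≤ n} r^k / k!`. -/
noncomputable def truncConst (r : ℝ) (n : ℕ) : ℝ :=
  Real.exp r / ∑ k ∈ Finset.range (n + 1), r ^ k / (k.factorial : ℝ)

/-- The right-truncated Poisson distribution with parameters `r` and `n`:
the probability that the number of defectives equals `d`. -/
noncomputable def truncPoisson (r : ℝ) (n d : ℕ) : ℝ :=
  if d ≤ n then truncConst r n * (r ^ d / (d.factorial : ℝ)) * Real.exp (-r) else 0

/-- The probability that the set of defectives is `S`: the cardinality follows the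
right-truncated Poisson distribution, and all sets of the same cardinality are equally likely. -/
noncomputable def defectiveProb (r : ℝ) (n : ℕ) (S : Finset (Fin n)) : ℝ :=
  truncPoisson r n S.card / (n.choose S.card : ℝ)

/-- A test matrix with `m` tests (rows) and `n` subjects (columns);
the entry `C i j` says whether subject `j` is present in test `i`. -/
abbrev TestMatrix (m n : ℕ) : Type := Matrix (Fin m) (Fin n) Bool

/-- The probability of the matrix `C` when the entries are i.i.d. Bernoulli(`p`). -/
noncomputable def matrixProb (p : ℝ) {m n : ℕ} (C : TestMatrix m n) : ℝ :=
  ∏ i : Fin m, ∏ j : Fin n, if C i j = true then p else 1 - p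

/-- The vector of test results: a test is positive iff it contains at least one defective. -/
def testResult {m n : ℕ} (C : TestMatrix m n) (S : Finset (Fin n)) : Fin m → Bool :=
  fun i => decide (∃ j ∈ S, C i j = true)

/-- The conditional probability `P(y | C, S)` of observing `y` given the test matrix `C` and the
set of defectives `S`; the tests are noiseless, so this law is a point mass. -/
noncomputable def likelihood {m n : ℕ} (C : TestMatrix m n) (S : Finset (Fin n))
    (y : Fin m → Bool) : ℝ :=
  if y = testResult C S then 1 else 0

open Classical in
/-- The probability of an event `A` about the pair (set of defectives, test matrix), where the
defectives follow the Poisson model with parameter `r`, the matrix has i.i.d. Bernoulli(`p`)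
entries, and the two are independent. -/
noncomputable def prob (r p : ℝ) {m n : ℕ} (A : Set (Finset (Fin n) × TestMatrix m n)) : ℝ :=
  ∑ S : Finset (Fin n), ∑ C : TestMatrix m n,
    if (S, C) ∈ A then defectiveProb r n S * matrixProb p C else 0

/-- A decoder maps a test matrix and a vector of test results to a set of subjects. -/
abbrev Decoder (m n : ℕ) : Type := TestMatrix m n → (Fin m → Bool) → Finset (Fin n)

/-- A maximum likelihood decoder, with arbitrary tie breaking: its output maximizes
`P(y | C, S')` over all sets of subjects `S'`. -/
def IsML {m n : ℕ} (f : Decoder m n) : Prop :=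
  ∀ (C : TestMatrix m n) (y : Fin m → Bool) (S' : Finset (Fin n)),
    likelihood C S' y ≤ likelihood C (f C y) y

/-- The event that the decoder `f` does not return the set of defectives. -/
def errorEvent {m n : ℕ} (f : Decoder m n) : Set (Finset (Fin n) × TestMatrix m n) :=
  {x | f x.2 (testResult x.2 x.1) ≠ x.1}

/-- The event that some set `S'` other than the set of defectives is at least as likely as it,
given the test matrix and the test results. -/
def ambiguityEvent (m n : ℕ) : Set (Finset (Fin n) × TestMatrix m n) :=
  {x | ∃ S' : Finset (Fin n), S' ≠ x.1 ∧
    likelihood x.2 x.1 (testResult x.2 x.1) ≤ likelihood x.2 S' (testResult x.2 x.1)}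

/-- The `K`-fold iterated natural logarithm of `n`. -/
noncomputable def iterLog (K n : ℕ) : ℝ := Real.log^[K] (n : ℝ)

/-- The Bernoulli parameter `⌈β λ⌉ ^ (-(1 + γ))`, as a function of `h = β λ`. -/
noncomputable def bernoulliParam (γ h : ℝ) : ℝ := ((⌈h⌉ : ℤ) : ℝ) ^ (-(1 + γ))

/-- The number `2 (β λ)^(1+γ) (log n + τ β² log² (β λ))`, as a function of `β = b`, `λ = r`. -/
noncomputable def testCount (γ τ b r : ℝ) (n : ℕ) : ℝ :=
  2 * (b * r) ^ (1 + γ) * (Real.log n + τ * b ^ 2 * Real.log (b * r) ^ 2)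

end PoissonPGT

/-! Tests are noiseless, so a rival set is as likely as the true set `S` exactly when it produces
the same results. Then some column `j` is covered by the columns of `S \ {j}`
(`exists_covered_of_ambiguous`). This replaces a union over exponentially many rivals by a union
over `n` subjects.

For `d` other defectives, a test exposes `j` with probability `p(1-p)^d`, and tests are independent.
So when `|S| ≤ T` the ambiguity probability is at most `n exp(-mp(1-Tp))`. Markov's inequality
bounds the probability of `|S| > T` by `λ/T`, the truncated mean being at most `λ`.

Take `T = h = βλ → ∞`. Then `λ/T = 1/β → 0`. Since `p` is asymptotic to `h^{-(1+γ)}`, `Tp → 0`, and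
the lower bound on `m` makes `mp(1-Tp)` at least `(3/2) log n` eventually. The union bound is thus
at most `n^{-1/2}`. -/

namespace PoissonPGT

/-! ### Random test matrices and covered columns -/

/-- A sum over test matrices of a product of a function of the rows factors. -/
lemma sum_matrix_prod_row {m n : ℕ} (F : (Fin n → Bool) → ℝ) :
    ∑ C : TestMatrix m n, ∏ i, F (C i) = (∑ x, F x) ^ m := by
  have h := Finset.prod_univ_sum (fun _ : Fin m => (Finset.univ : Finset (Fin n → Bool)))
    (fun _ x => F x)
  rw [Fintype.piFinset_univ, Finset.prod_const, Finset.card_univ, Fintype.card_fin] at h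
  rw [h]
  exact Finset.sum_congr (Finset.ext fun _ => ⟨fun _ => Finset.mem_univ _,
    fun _ => Finset.mem_univ _⟩) fun _ _ => rfl

lemma matrixProb_nonneg {p : ℝ} (h0 : 0 ≤ p) (h1 : p ≤ 1) {m n : ℕ} (C : TestMatrix m n) :
    0 ≤ matrixProb p C := by
  refine Finset.prod_nonneg fun i _ => Finset.prod_nonneg fun j _ => ?_
  split_ifs <;> linarith

lemma sum_row (p : ℝ) (n : ℕ) :
    ∑ x : Fin n → Bool, ∏ j, (if x j = true then p else 1 - p) = 1 := by
  have h := Finset.prod_univ_sum (fun _ : Fin n => (Finset.univ : Finset Bool))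
    (fun _ b => if b = true then p else 1 - p)
  rw [Fintype.piFinset_univ] at h
  rw [← h]
  simp

lemma sum_matrixProb (p : ℝ) (m n : ℕ) : ∑ C : TestMatrix m n, matrixProb p C = 1 := by
  unfold matrixProb
  rw [sum_matrix_prod_row (fun x => ∏ j, if x j = true then p else 1 - p), sum_row, one_pow]

/-- The probability that a row contains `j` and avoids `S`. -/
lemma sum_row_isolated (p : ℝ) {n : ℕ} {j : Fin n} {S : Finset (Fin n)} (hj : j ∉ S) :
    ∑ x : Fin n → Bool, (if x j = true ∧ ∀ k ∈ S, x k = false then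
      ∏ k, (if x k = true then p else 1 - p) else 0) = p * (1 - p) ^ S.card := by
  classical
  -- The event constrains each entry separately, so its indicator can be absorbed into the factors.
  set g : Fin n → Bool → ℝ := fun k b =>
    if k = j then (if b = true then p else 0)
    else if k ∈ S then (if b = true then 0 else 1 - p) else (if b = true then p else 1 - p)
    with hg
  have h := Finset.prod_univ_sum (fun _ : Fin n => (Finset.univ : Finset Bool)) g
  rw [Fintype.piFinset_univ] at h
  have hb : ∀ k, ∑ b, g k b = (if k = j then p else 1) * (if k ∈ S then 1 - p else 1) := by
    intro k
    by_cases hk : k = j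
    · subst hk; simp [hg, hj]
    · by_cases hS : k ∈ S <;> simp [hg, hk, hS]
  have hx : ∀ x : Fin n → Bool, (if x j = true ∧ ∀ k ∈ S, x k = false then
      ∏ k, (if x k = true then p else 1 - p) else 0) = ∏ k, g k (x k) := by
    intro x
    split_ifs with hc
    · refine Finset.prod_congr rfl fun k _ => ?_
      by_cases hk : k = j
      · subst hk; simp [hg, hc.1]
      · by_cases hS : k ∈ S
        · simp [hg, hk, hS, hc.2 k hS]
        · simp [hg, hk, hS]
    · symm
      by_cases hxj : x j = true
      · obtain ⟨k, hkS, hk⟩ : ∃ k ∈ S, x k = true := by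
          by_contra hcon
          push Not at hcon
          exact hc ⟨hxj, fun k hk => by simpa using hcon k hk⟩
        refine Finset.prod_eq_zero (Finset.mem_univ k) ?_
        have : k ≠ j := fun h => hj (h ▸ hkS)
        simp [hg, this, hkS, hk]
      · refine Finset.prod_eq_zero (Finset.mem_univ j) ?_
        simp [hg, hxj]
  rw [Finset.sum_congr rfl fun x _ => hx x, ← h, Finset.prod_congr rfl fun k _ => hb k,
    Finset.prod_mul_distrib, Finset.prod_ite_eq' Finset.univ j]
  simp [Finset.prod_ite_mem]

open Classical in
/-- The probability that column `j` is covered by the union of the columns in `S`. -/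
lemma sum_covered (p : ℝ) {m n : ℕ} {j : Fin n} {S : Finset (Fin n)} (hj : j ∉ S) :
    ∑ C : TestMatrix m n, (if ∀ i, C i j = true → ∃ k ∈ S, C i k = true then
      matrixProb p C else 0) = (1 - p * (1 - p) ^ S.card) ^ m := by
  set w : (Fin n → Bool) → ℝ := fun x => ∏ k, (if x k = true then p else 1 - p) with hw
  -- Coverage means that no row contains `j` while avoiding `S`; `F` is the row weight with such
  -- rows deleted.
  set F : (Fin n → Bool) → ℝ := fun x =>
    w x - (if x j = true ∧ ∀ k ∈ S, x k = false then w x else 0) with hF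
  have hsum : ∑ x, F x = 1 - p * (1 - p) ^ S.card := by
    rw [hF, Finset.sum_sub_distrib, sum_row_isolated p hj, sum_row]
  rw [← hsum, ← sum_matrix_prod_row]
  refine Finset.sum_congr rfl fun C _ => ?_
  split_ifs with hc
  · refine Finset.prod_congr rfl fun i _ => ?_
    have : ¬ (C i j = true ∧ ∀ k ∈ S, C i k = false) := by
      rintro ⟨h1, h2⟩
      obtain ⟨k, hk, hk'⟩ := hc i h1
      simp [h2 k hk] at hk'
    simp [hF, hw, this]
  · push Not at hc
    obtain ⟨i, h1, h2⟩ := hc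
    refine (Finset.prod_eq_zero (Finset.mem_univ i) ?_).symm
    have : C i j = true ∧ ∀ k ∈ S, C i k = false := ⟨h1, fun k hk => by simpa using h2 k hk⟩
    simp only [hF]
    rw [if_pos this, sub_self]

/-- Bernoulli's inequality gives `(1-p)^d ≥ 1 - dp ≥ 1 - Tp`; then `1 - x ≤ exp(-x)`. -/
lemma covered_le_exp {p T : ℝ} (h0 : 0 ≤ p) (h1 : p ≤ 1) {d m : ℕ} (hd : (d : ℝ) ≤ T) :
    (1 - p * (1 - p) ^ d) ^ m ≤ Real.exp (-(m * p * (1 - T * p))) := by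
  have hle : (1 - p) ^ d ≤ 1 := pow_le_one₀ (by linarith) (by linarith)
  have hnn : 0 ≤ (1 - p) ^ d := pow_nonneg (by linarith) d
  have hb : 1 + (d : ℝ) * (-p) ≤ (1 + (-p)) ^ d := one_add_mul_le_pow (by linarith) d
  have hb' : 1 - T * p ≤ (1 - p) ^ d := by
    have : (d : ℝ) * p ≤ T * p := mul_le_mul_of_nonneg_right hd h0
    rw [← sub_eq_add_neg] at hb
    linarith
  have hx : 1 - p * (1 - p) ^ d ≤ Real.exp (-(p * (1 - T * p))) := by
    have h2 := Real.add_one_le_exp (-(p * (1 - T * p)))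
    have := mul_le_mul_of_nonneg_left hb' h0
    linarith
  calc (1 - p * (1 - p) ^ d) ^ m ≤ Real.exp (-(p * (1 - T * p))) ^ m :=
        pow_le_pow_left₀ (by nlinarith) hx m
    _ = Real.exp (-(m * p * (1 - T * p))) := by rw [← Real.exp_nat_mul]; ring_nf

/-! ### From ambiguity to covered columns -/

/-- If another set explains the test results, then the column of some subject is covered by the
columns of the defectives other than that subject. -/
lemma exists_covered_of_ambiguous {m n : ℕ} {S : Finset (Fin n)} {C : TestMatrix m n}
    (h : (S, C) ∈ ambiguityEvent m n) :
    ∃ j, ∀ i, C i j = true → ∃ k ∈ S.erase j, C i k = true := by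
  obtain ⟨S', hne, hlik⟩ := h
  have heq : testResult C S = testResult C S' := by
    by_contra hcon
    simp only [likelihood, if_neg hcon, if_true] at hlik
    norm_num at hlik
  have hiff : ∀ i, (∃ k ∈ S, C i k = true) ↔ ∃ k ∈ S', C i k = true := fun i => by
    simpa [testResult] using congrFun heq i
  -- If `S' ⊊ S`, any `j ∈ S \ S'` is redundant; otherwise any `j ∈ S' \ S` is covered by `S`, where
  -- erasing `j` changes nothing.
  by_cases hsub : S' ⊆ S
  · obtain ⟨j, hjS, hj⟩ := Finset.exists_of_ssubset (hsub.ssubset_of_ne hne)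
    refine ⟨j, fun i hi => ?_⟩
    obtain ⟨k, hk, hk'⟩ := (hiff i).1 ⟨j, hjS, hi⟩
    exact ⟨k, Finset.mem_erase.2 ⟨fun h => hj (h ▸ hk), hsub hk⟩, hk'⟩
  · obtain ⟨j, hj, hjS⟩ := Finset.not_subset.1 hsub
    refine ⟨j, fun i hi => ?_⟩
    rw [Finset.erase_eq_of_notMem hjS]
    exact (hiff i).2 ⟨j, hj, hi⟩

open Classical in
lemma sum_ambiguous_le {p T : ℝ} (h0 : 0 ≤ p) (h1 : p ≤ 1) {m n : ℕ} {S : Finset (Fin n)}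
    (hS : (S.card : ℝ) ≤ T) :
    ∑ C : TestMatrix m n, (if (S, C) ∈ ambiguityEvent m n then matrixProb p C else 0) ≤
      n * Real.exp (-(m * p * (1 - T * p))) := by
  calc ∑ C : TestMatrix m n, (if (S, C) ∈ ambiguityEvent m n then matrixProb p C else 0)
      ≤ ∑ C : TestMatrix m n, ∑ j : Fin n,
          (if ∀ i, C i j = true → ∃ k ∈ S.erase j, C i k = true then matrixProb p C else 0) := by
        refine Finset.sum_le_sum fun C _ => ?_
        have hnn : ∀ j ∈ (Finset.univ : Finset (Fin n)), 0 ≤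
            (if ∀ i, C i j = true → ∃ k ∈ S.erase j, C i k = true then
              matrixProb p C else 0) := fun j _ => by
          split_ifs
          exacts [matrixProb_nonneg h0 h1 C, le_rfl]
        split_ifs with hA
        · obtain ⟨j, hj⟩ := exists_covered_of_ambiguous hA
          have := Finset.single_le_sum hnn (Finset.mem_univ j)
          rwa [if_pos hj] at this
        · exact Finset.sum_nonneg hnn
    _ = ∑ j : Fin n, (1 - p * (1 - p) ^ (S.erase j).card) ^ m := by
        rw [Finset.sum_comm]
        exact Finset.sum_congr rfl fun j _ => sum_covered p (Finset.notMem_erase j S)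
    _ ≤ ∑ _j : Fin n, Real.exp (-(m * p * (1 - T * p))) := by
        refine Finset.sum_le_sum fun j _ => covered_le_exp h0 h1 (le_trans ?_ hS)
        exact_mod_cast Finset.card_le_card (Finset.erase_subset j S)
    _ = n * Real.exp (-(m * p * (1 - T * p))) := by simp

/-! ### The truncated Poisson law -/

lemma sum_pow_div_factorial_pos {r : ℝ} (hr : 0 ≤ r) (n : ℕ) :
    0 < ∑ k ∈ Finset.range (n + 1), r ^ k / (k.factorial : ℝ) := by
  rw [Finset.sum_range_succ']
  have : 0 ≤ ∑ k ∈ Finset.range n, r ^ (k + 1) / ((k + 1).factorial : ℝ) :=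
    Finset.sum_nonneg fun k _ => by positivity
  simp only [pow_zero, Nat.factorial_zero, Nat.cast_one, div_one]
  linarith

lemma truncPoisson_eq (r : ℝ) {n d : ℕ} (hd : d ≤ n) :
    truncPoisson r n d = (r ^ d / (d.factorial : ℝ)) /
      ∑ k ∈ Finset.range (n + 1), r ^ k / (k.factorial : ℝ) := by
  have h : Real.exp r * Real.exp (-r) = 1 := by rw [← Real.exp_add]; simp
  rw [truncPoisson, if_pos hd, truncConst]
  linear_combination (r ^ d / (d.factorial : ℝ)) /
      (∑ k ∈ Finset.range (n + 1), r ^ k / (k.factorial : ℝ)) * h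

lemma truncPoisson_nonneg {r : ℝ} (hr : 0 ≤ r) (n d : ℕ) : 0 ≤ truncPoisson r n d := by
  by_cases hd : d ≤ n
  · rw [truncPoisson_eq r hd]
    have := sum_pow_div_factorial_pos hr n
    positivity
  · simp [truncPoisson, hd]

lemma sum_truncPoisson {r : ℝ} (hr : 0 ≤ r) (n : ℕ) :
    ∑ d ∈ Finset.range (n + 1), truncPoisson r n d = 1 := by
  rw [Finset.sum_congr rfl fun d hd =>
    truncPoisson_eq r (Nat.lt_succ_iff.1 (Finset.mem_range.1 hd)), ← Finset.sum_div]
  exact div_self (sum_pow_div_factorial_pos hr n).ne'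

/-- The mean of the right-truncated Poisson distribution is at most its parameter. -/
lemma mean_truncPoisson_le {r : ℝ} (hr : 0 ≤ r) (n : ℕ) :
    ∑ d ∈ Finset.range (n + 1), (d : ℝ) * truncPoisson r n d ≤ r := by
  have hpos := sum_pow_div_factorial_pos hr n
  have h1 : ∑ d ∈ Finset.range (n + 1), (d : ℝ) * truncPoisson r n d =
      (∑ d ∈ Finset.range (n + 1), (d : ℝ) * (r ^ d / (d.factorial : ℝ))) /
        ∑ k ∈ Finset.range (n + 1), r ^ k / (k.factorial : ℝ) := by
    rw [Finset.sum_div]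
    refine Finset.sum_congr rfl fun d hd => ?_
    rw [truncPoisson_eq r (Nat.lt_succ_iff.1 (Finset.mem_range.1 hd)), mul_div_assoc]
  -- As `d r^d/d! = r · r^(d-1)/(d-1)!`, the numerator is `r` times the normalizing sum without its
  -- top term, `k = n`.
  rw [h1, div_le_iff₀ hpos, Finset.sum_range_succ', Finset.sum_range_succ _ n, mul_add,
    Finset.mul_sum]
  have h2 : ∀ k ∈ Finset.range n, ((k + 1 : ℕ) : ℝ) * (r ^ (k + 1) / ((k + 1).factorial : ℝ)) =
      r * (r ^ k / (k.factorial : ℝ)) := fun k _ => by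
    have : ((k : ℝ) + 1) ≠ 0 := by positivity
    have : (k.factorial : ℝ) ≠ 0 := by positivity
    rw [Nat.factorial_succ, pow_succ']
    push_cast
    field_simp
  rw [Finset.sum_congr rfl h2]
  have : 0 ≤ r * (r ^ n / (n.factorial : ℝ)) := by positivity
  simpa using this

lemma defectiveProb_nonneg {r : ℝ} (hr : 0 ≤ r) {n : ℕ} (S : Finset (Fin n)) :
    0 ≤ defectiveProb r n S :=
  div_nonneg (truncPoisson_nonneg hr n _) (Nat.cast_nonneg _)

/-- The expectation of a function of the number of defectives. -/
lemma sum_defectiveProb_mul (r : ℝ) (n : ℕ) (f : ℕ → ℝ) :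
    ∑ S : Finset (Fin n), f S.card * defectiveProb r n S =
      ∑ d ∈ Finset.range (n + 1), f d * truncPoisson r n d := by
  have h := Finset.sum_powerset_apply_card
    (fun d => f d * (truncPoisson r n d / (n.choose d : ℝ))) (x := (Finset.univ : Finset (Fin n)))
  rw [Finset.powerset_univ, Finset.card_univ, Fintype.card_fin] at h
  unfold defectiveProb
  rw [h]
  refine Finset.sum_congr rfl fun d hd => ?_
  have : (n.choose d : ℝ) ≠ 0 :=
    Nat.cast_ne_zero.2 (Nat.choose_pos (Nat.lt_succ_iff.1 (Finset.mem_range.1 hd))).ne'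
  rw [nsmul_eq_mul]
  field_simp

/-! ### Bounding the ambiguity probability -/

lemma prob_nonneg {r p : ℝ} (hr : 0 ≤ r) (h0 : 0 ≤ p) (h1 : p ≤ 1) {m n : ℕ}
    (A : Set (Finset (Fin n) × TestMatrix m n)) : 0 ≤ prob r p A := by
  refine Finset.sum_nonneg fun S _ => Finset.sum_nonneg fun C _ => ?_
  split_ifs
  exacts [mul_nonneg (defectiveProb_nonneg hr S) (matrixProb_nonneg h0 h1 C), le_rfl]

lemma prob_mono {r p : ℝ} (hr : 0 ≤ r) (h0 : 0 ≤ p) (h1 : p ≤ 1) {m n : ℕ}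
    {A B : Set (Finset (Fin n) × TestMatrix m n)} (hAB : A ⊆ B) : prob r p A ≤ prob r p B := by
  refine Finset.sum_le_sum fun S _ => Finset.sum_le_sum fun C _ => ?_
  have := mul_nonneg (defectiveProb_nonneg hr S) (matrixProb_nonneg h0 h1 C)
  by_cases hA : (S, C) ∈ A
  · rw [if_pos hA, if_pos (hAB hA)]
  · rw [if_neg hA]
    split_ifs
    exacts [this, le_rfl]

/-- A wrong ML output is itself the rival set, whatever the tie breaking. -/
lemma errorEvent_subset_ambiguityEvent {m n : ℕ} {f : Decoder m n} (hf : IsML f) :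
    errorEvent f ⊆ ambiguityEvent m n :=
  fun x hx => ⟨f x.2 (testResult x.2 x.1), hx, hf x.2 _ x.1⟩

/-- Union bound for the ambiguity event, with Markov's inequality for the number of defectives. -/
lemma prob_ambiguityEvent_le {r p T : ℝ} (hr : 0 ≤ r) (h0 : 0 ≤ p) (h1 : p ≤ 1) (hT : 0 < T)
    (m n : ℕ) :
    prob r p (ambiguityEvent m n) ≤ n * Real.exp (-(m * p * (1 - T * p))) + r / T := by
  classical
  set E := (n : ℝ) * Real.exp (-(m * p * (1 - T * p))) with hE
  have hE0 : 0 ≤ E := by positivity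
  have hS : ∀ S : Finset (Fin n),
      -- Markov's inequality in pointwise form: `|S|/T` dominates the trivial bound `1` when `|S| >
      -- T`, so averaging over `S` needs only the mean.
      ∑ C : TestMatrix m n, (if (S, C) ∈ ambiguityEvent m n then matrixProb p C else 0) ≤
        E + S.card / T := by
    intro S
    rcases le_or_gt (S.card : ℝ) T with h | h
    · have := sum_ambiguous_le (m := m) h0 h1 h
      have h' : 0 ≤ (S.card : ℝ) / T := by positivity
      linarith
    · have h' : 1 ≤ (S.card : ℝ) / T := (one_le_div hT).2 h.le
      have : ∑ C : TestMatrix m n, (if (S, C) ∈ ambiguityEvent m n then matrixProb p C else 0) ≤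
          ∑ C : TestMatrix m n, matrixProb p C := by
        refine Finset.sum_le_sum fun C _ => ?_
        split_ifs
        exacts [le_rfl, matrixProb_nonneg h0 h1 C]
      rw [sum_matrixProb] at this
      linarith
  calc prob r p (ambiguityEvent m n)
      = ∑ S : Finset (Fin n), defectiveProb r n S *
          ∑ C : TestMatrix m n, (if (S, C) ∈ ambiguityEvent m n then matrixProb p C else 0) := by
        unfold prob
        refine Finset.sum_congr rfl fun S _ => ?_
        rw [Finset.mul_sum]
        refine Finset.sum_congr rfl fun C _ => ?_
        rw [mul_ite, mul_zero]
    _ ≤ ∑ S : Finset (Fin n), defectiveProb r n S * (E + S.card / T) :=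
        Finset.sum_le_sum fun S _ => mul_le_mul_of_nonneg_left (hS S) (defectiveProb_nonneg hr S)
    _ = ∑ S : Finset (Fin n), (E + S.card / T) * defectiveProb r n S :=
        Finset.sum_congr rfl fun S _ => mul_comm _ _
    _ = ∑ d ∈ Finset.range (n + 1), (E + d / T) * truncPoisson r n d :=
        sum_defectiveProb_mul r n fun d => E + d / T
    _ = E * ∑ d ∈ Finset.range (n + 1), truncPoisson r n d +
          (∑ d ∈ Finset.range (n + 1), (d : ℝ) * truncPoisson r n d) / T := by
        rw [Finset.mul_sum, Finset.sum_div, ← Finset.sum_add_distrib]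
        exact Finset.sum_congr rfl fun d _ => by ring
    _ ≤ E + r / T := by
        rw [sum_truncPoisson hr, mul_one]
        gcongr
        exact mean_truncPoisson_le hr n

/-! ### Asymptotics of the parameters -/

lemma tendsto_iterLog (K : ℕ) : Tendsto (iterLog K) atTop atTop :=
  (Real.tendsto_log_atTop.iterate K).comp tendsto_natCast_atTop_atTop

lemma tendsto_div_ceil_atTop : Tendsto (fun h : ℝ => h / ((⌈h⌉ : ℤ) : ℝ)) atTop (𝓝 1) := by
  have h := (tendsto_nat_ceil_div_atTop (R := ℝ)).inv₀ one_ne_zero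
  rw [inv_one] at h
  refine h.congr' ?_
  filter_upwards [eventually_ge_atTop 0] with x hx
  rw [inv_div, natCast_ceil_eq_intCast_ceil hx]

/-- The exponent per unit of `log n` in the union bound tends to `2`. -/
lemma tendsto_exponent {γ : ℝ} (hγ : 0 < γ) :
    Tendsto (fun h : ℝ => 2 * (h ^ (1 + γ) * bernoulliParam γ h) * (1 - h * bernoulliParam γ h))
      atTop (𝓝 2) := by
  have hratio := tendsto_div_ceil_atTop
  have h1 : Tendsto (fun h : ℝ => h ^ (1 + γ) * bernoulliParam γ h) atTop (𝓝 1) := by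
    have := hratio.rpow_const (p := 1 + γ) (Or.inl one_ne_zero)
    rw [Real.one_rpow] at this
    refine this.congr' ?_
    filter_upwards [eventually_gt_atTop 0] with h hh
    have hc : (0 : ℝ) < ((⌈h⌉ : ℤ) : ℝ) := hh.trans_le (Int.le_ceil h)
    rw [bernoulliParam, Real.rpow_neg hc.le, Real.div_rpow hh.le hc.le, div_eq_mul_inv]
  have h2 : Tendsto (fun h : ℝ => h * bernoulliParam γ h) atTop (𝓝 0) := by
    -- `h p = (h^(1+γ) p) · h^(-γ)`: this is where `γ > 0` makes `Tp` vanish.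
    have := h1.mul (tendsto_rpow_neg_atTop hγ)
    rw [mul_zero] at this
    refine this.congr' ?_
    filter_upwards [eventually_gt_atTop 0] with h hh
    have : h ^ (1 + γ) * h ^ (-γ) = h := by rw [← Real.rpow_add hh]; simp
    linear_combination bernoulliParam γ h * this
  have := (h1.const_mul 2).mul (h2.const_sub 1)
  simpa using this

lemma bernoulliParam_mem {γ h : ℝ} (hγ : 0 < γ) (hh : 1 ≤ h) :
    0 ≤ bernoulliParam γ h ∧ bernoulliParam γ h ≤ 1 := by
  have hc : (1 : ℝ) ≤ ((⌈h⌉ : ℤ) : ℝ) := hh.trans (Int.le_ceil h)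
  exact ⟨Real.rpow_nonneg (by linarith) _,
    Real.rpow_le_one_of_one_le_of_nonpos hc (by linarith)⟩

/-- With the prescribed number of tests, the union bound is at most `n ^ (-1/2)`. -/
lemma union_bound_le {γ τ b r : ℝ} (hτ : 0 < τ) {m n : ℕ} (hn : 1 ≤ n) (hbr : 1 ≤ b * r)
    (hp : 0 ≤ bernoulliParam γ (b * r)) (hm : testCount γ τ b r n ≤ m)
    (hexp : 3 / 2 ≤ 2 * ((b * r) ^ (1 + γ) * bernoulliParam γ (b * r)) *
      (1 - b * r * bernoulliParam γ (b * r))) :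
    n * Real.exp (-(m * bernoulliParam γ (b * r) * (1 - b * r * bernoulliParam γ (b * r)))) ≤
      Real.exp (-(Real.log n / 2)) := by
  set p := bernoulliParam γ (b * r)
  have hn0 : (0 : ℝ) < n := by exact_mod_cast hn
  have hlog : 0 ≤ Real.log n := Real.log_natCast_nonneg n
  have hpow : 0 < (b * r) ^ (1 + γ) := Real.rpow_pos_of_pos (by linarith) _
  have hq : 0 ≤ 1 - b * r * p := by
    by_contra hneg
    push Not at hneg
    have : 2 * ((b * r) ^ (1 + γ) * p) * (1 - b * r * p) ≤ 0 :=
      mul_nonpos_of_nonneg_of_nonpos (by positivity) hneg.le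
    linarith
  -- The `log n` part of the test count suffices; the `τ` part is nonnegative.
  have hm' : 2 * (b * r) ^ (1 + γ) * Real.log n ≤ m := by
    refine le_trans ?_ hm
    rw [testCount]
    refine mul_le_mul_of_nonneg_left ?_ (by positivity)
    have : 0 ≤ τ * b ^ 2 * Real.log (b * r) ^ 2 := by positivity
    linarith
  have h1 : 3 / 2 * Real.log n ≤ m * p * (1 - b * r * p) := by
    calc 3 / 2 * Real.log n
        ≤ 2 * ((b * r) ^ (1 + γ) * p) * (1 - b * r * p) * Real.log n :=
          mul_le_mul_of_nonneg_right hexp hlog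
      _ = 2 * (b * r) ^ (1 + γ) * Real.log n * (p * (1 - b * r * p)) := by ring
      _ ≤ m * (p * (1 - b * r * p)) := mul_le_mul_of_nonneg_right hm' (mul_nonneg hp hq)
      _ = m * p * (1 - b * r * p) := by ring
  calc (n : ℝ) * Real.exp (-(m * p * (1 - b * r * p)))
      = Real.exp (Real.log n + -(m * p * (1 - b * r * p))) := by
        rw [Real.exp_add, Real.exp_log hn0]
    _ ≤ Real.exp (-(Real.log n / 2)) := Real.exp_le_exp.2 (by linarith)

end PoissonPGT

theorem theorem11 (lam : ℕ → ℝ) (hnonneg : ∀ n, 0 ≤ lam n)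
    (hsub : lam =o[atTop] fun n : ℕ => (n : ℝ))
    (L : ℝ) (hL : 0 < L) (hlim : Tendsto lam atTop (𝓝 L))
    (K : ℕ) (hK : 1 < K) (γ τ : ℝ) (hγ : 0 < γ) (hτ : 0 < τ)
    (m : ℕ → ℕ)
    (hm : ∀ᶠ n in atTop,
      PoissonPGT.testCount γ τ (PoissonPGT.iterLog K n) (lam n) n ≤ (m n : ℝ)) :
    Tendsto (fun n : ℕ =>
        PoissonPGT.prob (lam n)
          (PoissonPGT.bernoulliParam γ (PoissonPGT.iterLog K n * lam n))
          (PoissonPGT.ambiguityEvent (m n) n)) atTop (𝓝 0) ∧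
      ∀ f : (n : ℕ) → PoissonPGT.Decoder (m n) n, (∀ n, PoissonPGT.IsML (f n)) →
        Tendsto (fun n : ℕ =>
          PoissonPGT.prob (lam n)
            (PoissonPGT.bernoulliParam γ (PoissonPGT.iterLog K n * lam n))
            (PoissonPGT.errorEvent (f n))) atTop (𝓝 0) := by
  have hβ := PoissonPGT.tendsto_iterLog K
  have hh : Tendsto (fun n => PoissonPGT.iterLog K n * lam n) atTop atTop :=
    hβ.atTop_mul_pos hL hlim
  have hparam : ∀ᶠ n in atTop,
      0 ≤ PoissonPGT.bernoulliParam γ (PoissonPGT.iterLog K n * lam n) ∧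
        PoissonPGT.bernoulliParam γ (PoissonPGT.iterLog K n * lam n) ≤ 1 := by
    filter_upwards [hh.eventually_ge_atTop 1] with n hn
    exact PoissonPGT.bernoulliParam_mem hγ hn
  have hbound : ∀ᶠ n in atTop,
      PoissonPGT.prob (lam n)
          (PoissonPGT.bernoulliParam γ (PoissonPGT.iterLog K n * lam n))
          (PoissonPGT.ambiguityEvent (m n) n) ≤
        Real.exp (-(Real.log n / 2)) + (PoissonPGT.iterLog K n)⁻¹ := by
    filter_upwards [hm, hparam, hh.eventually_ge_atTop 1, eventually_ge_atTop 1,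
      hlim.eventually_const_lt hL,
      -- Any constant strictly between 1 and the limit 2 would do: exceeding 1 beats the factor `n`.
      (hh.eventually ((PoissonPGT.tendsto_exponent hγ).eventually_const_le
        (show (3 / 2 : ℝ) < 2 by norm_num)))] with n hmn hp hn hn1 hlam hexp
    -- The threshold is `T = βλ`, so the Markov term is `1/β`.
    have h1 := PoissonPGT.prob_ambiguityEvent_le (hnonneg n) hp.1 hp.2
      (zero_lt_one.trans_le hn) (m n) n
    have h2 := PoissonPGT.union_bound_le hτ hn1 hn hp.1 hmn hexp
    have h3 : lam n / (PoissonPGT.iterLog K n * lam n) = (PoissonPGT.iterLog K n)⁻¹ := by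
      rw [mul_comm, div_mul_eq_div_div, div_self hlam.ne', one_div]
    linarith
  have hzero : Tendsto (fun n : ℕ =>
      Real.exp (-(Real.log n / 2)) + (PoissonPGT.iterLog K n)⁻¹) atTop (𝓝 0) := by
    have h1 : Tendsto (fun n : ℕ => Real.exp (-(Real.log n / 2))) atTop (𝓝 0) :=
      Real.tendsto_exp_neg_atTop_nhds_zero.comp
        ((Real.tendsto_log_atTop.comp tendsto_natCast_atTop_atTop).atTop_div_const two_pos)
    simpa using h1.add (tendsto_inv_atTop_zero.comp hβ)
  have hamb : Tendsto (fun n : ℕ =>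
      PoissonPGT.prob (lam n)
        (PoissonPGT.bernoulliParam γ (PoissonPGT.iterLog K n * lam n))
        (PoissonPGT.ambiguityEvent (m n) n)) atTop (𝓝 0) := by
    refine squeeze_zero' ?_ hbound hzero
    filter_upwards [hparam] with n hp
    exact PoissonPGT.prob_nonneg (hnonneg n) hp.1 hp.2 _
  refine ⟨hamb, fun f hf => squeeze_zero' ?_ ?_ hamb⟩
  · filter_upwards [hparam] with n hp
    exact PoissonPGT.prob_nonneg (hnonneg n) hp.1 hp.2 _
  · filter_upwards [hparam] with n hp
    exact PoissonPGT.prob_mono (hnonneg n) hp.1 hp.2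
      (PoissonPGT.errorEvent_subset_ambiguityEvent (hf n))
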